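/- For $m\in\mathbb{N}=\{0,1,2,\dots\}$ let $P_m$ be the $(m+1)$-dimensional complex vector space of homogeneous polynomials of degree $m$ in two variables $x_1,x_2$, with the inner product determined by $\langle x_1^{l}x_2^{m-l},\,x_1^{k}x_2^{m-k}\rangle=l!\,(m-l)!\,\delta_{lk}$ for $0\le l,k\le m$, and let $\rho_m$ be the representation of $SU(2)$ on $P_m$ given by $(\rho_m(g)f)(x_1,x_2)=f((x_1,x_2)g)$, where $(x_1,x_2)g$ is the product of a row vector with a matrix. For a finite-dimensional complex Hilbert space $H$, let $\mathrm{End}(H)$ be the algebra of linear maps $H\to H$. Given representations $\pi_H,\pi_K$ of a group $G$ on finite-dimensional Hilbert spaces $H,K$, a linear map $\Phi:\mathrm{End}(H)\to\mathrm{End}(K)$ is called $G$-equivariant if $\Phi(\pi_H(g)A\pi_H(g)^{-1})=\pi_K(g)\Phi(A)\pi_K(g)^{-1}$ for all $g\in G$ and $A\in\mathrm{End}(H)$; it is a quantum channel if it is completely positive and trace preserving; and it is a $G$-irreducibly covariant channel if it is a $G$-equivariant quantum channel and both $\pi_H$ and $\pi_K$ are irreducible. Corollary 4.2. Let $r,m\in\mathbb{N}$,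 and let $\Phi:\mathrm{End}(P_r)\to\mathrm{End}(P_m)$ be a completely positive linear map that is $SU(2)$-equivariant with respect to $\rho_r$ and $\rho_m$. Then there are a real number $c\ge 0$ and an $SU(2)$-irreducibly covariant channel $\Psi:\mathrm{End}(P_r)\to\mathrm{End}(P_m)$ (with respect to $\rho_r$ and $\rho_m$) such that $\Phi=c\,\Psi$. -/

import Mathlib

namespace SU2Covariant

open MvPolynomial CStarAlgebra
open scoped Nat ComplexOrder ComplexConjugate

/-! ### The spaces of binary forms -/

/-- `BinaryForm m` is `P_m`, the space of homogeneous polynomials of degree `m` in two variables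
`x₁ = X 0`, `x₂ = X 1`, with complex coefficients. -/
def BinaryForm (m : ℕ) : Type :=
  homogeneousSubmodule (Fin 2) ℂ m

namespace BinaryForm

noncomputable instance (m : ℕ) : AddCommGroup (BinaryForm m) :=
  inferInstanceAs (AddCommGroup (homogeneousSubmodule (Fin 2) ℂ m))

noncomputable instance (m : ℕ) : Module ℂ (BinaryForm m) :=
  inferInstanceAs (Module ℂ (homogeneousSubmodule (Fin 2) ℂ m))

/-- The inclusion of `P_m` into the polynomial ring `ℂ[x₁, x₂]`. -/
noncomputable def toPoly (m : ℕ) : BinaryForm m →ₗ[ℂ] MvPolynomial (Fin 2) ℂ :=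
  (homogeneousSubmodule (Fin 2) ℂ m).subtype

theorem toPoly_injective (m : ℕ) : Function.Injective (toPoly m) :=
  (homogeneousSubmodule (Fin 2) ℂ m).injective_subtype

theorem toPoly_isHomogeneous {m : ℕ} (f : BinaryForm m) : (toPoly m f).IsHomogeneous m :=
  f.2

/-- A homogeneous polynomial of degree `m`, as an element of `P_m`. -/
def ofPoly {m : ℕ} (p : MvPolynomial (Fin 2) ℂ) (hp : p.IsHomogeneous m) : BinaryForm m :=
  ⟨p, hp⟩

@[simp]
theorem toPoly_ofPoly {m : ℕ} (p : MvPolynomial (Fin 2) ℂ) (hp : p.IsHomogeneous m) :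
    toPoly m (ofPoly p hp) = p :=
  rfl

instance (m : ℕ) : FiniteDimensional ℂ (BinaryForm m) :=
  Module.Finite.iff_fg.mpr (homogeneousSubmodule_fg (Fin 2) ℂ m)

/-- The exponent of the monomial `x₁ ^ l * x₂ ^ (m - l)`. -/
noncomputable def expo (m l : ℕ) : Fin 2 →₀ ℕ :=
  Finsupp.single 0 l + Finsupp.single 1 (m - l)

/-- The coefficient of `x₁ ^ l * x₂ ^ (m - l)` in `f`. -/
noncomputable def coef {m : ℕ} (l : ℕ) (f : BinaryForm m) : ℂ :=
  MvPolynomial.coeff (expo m l) (toPoly m f)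

theorem eq_zero_of_coef {m : ℕ} {f : BinaryForm m}
    (h : ∀ l ∈ Finset.range (m + 1), coef l f = 0) : f = 0 := by
  apply toPoly_injective m
  rw [map_zero]
  ext d
  by_contra hd
  have hdeg : d.degree = m := by
    have := toPoly_isHomogeneous f hd
    rw [show (1 : Fin 2 → ℕ) = fun _ => 1 from rfl, ← Finsupp.degree_eq_weight_one] at this
    exact this
  have hsum : d 0 + d 1 = m := by
    rw [← hdeg, Finsupp.degree_eq_sum, Fin.sum_univ_two]
  have hd' : expo m (d 0) = d := by
    ext i
    fin_cases i
    · simp [expo]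
    · simp [expo]; omega
  have h0 := h (d 0) (Finset.mem_range.mpr (by omega))
  rw [coef, hd'] at h0
  exact hd (by simpa using h0)

/-- The inner product on `P_m`, conjugate-linear in the first argument, for which
`⟪x₁ ^ l * x₂ ^ (m - l), x₁ ^ k * x₂ ^ (m - k)⟫ = l! (m - l)! δ_{lk}`. -/
@[reducible] noncomputable def core (m : ℕ) : InnerProductSpace.Core ℂ (BinaryForm m) where
  inner f g := ∑ l ∈ Finset.range (m + 1), ((l ! * (m - l)! : ℕ) : ℂ) * (conj (coef l f) * coef l g)
  conj_inner_symm f g := by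
    simp only [map_sum, map_mul, Complex.conj_conj, Complex.conj_natCast]
    exact Finset.sum_congr rfl fun l _ => by ring
  re_inner_nonneg f := by
    rw [map_sum]
    refine Finset.sum_nonneg fun l _ => ?_
    rw [← Complex.normSq_eq_conj_mul_self, ← Complex.ofReal_natCast, ← Complex.ofReal_mul]
    exact mul_nonneg (Nat.cast_nonneg _) (Complex.normSq_nonneg _)
  add_left f g k := by
    simp only [coef, map_add, MvPolynomial.coeff_add, ← Finset.sum_add_distrib]
    exact Finset.sum_congr rfl fun l _ => by ring
  smul_left f g c := by
    simp only [coef, map_smul, MvPolynomial.coeff_smul, smul_eq_mul, map_mul, Finset.mul_sum]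
    exact Finset.sum_congr rfl fun l _ => by ring
  definite f hf := by
    apply eq_zero_of_coef
    have key : (∑ l ∈ Finset.range (m + 1),
        ((l ! * (m - l)! : ℕ) : ℝ) * Complex.normSq (coef l f)) = 0 := by
      have h : ((∑ l ∈ Finset.range (m + 1),
        ((l ! * (m - l)! : ℕ) : ℝ) * Complex.normSq (coef l f) : ℝ) : ℂ) = 0 := by
        rw [← hf]
        push_cast
        exact Finset.sum_congr rfl fun l _ => by rw [Complex.normSq_eq_conj_mul_self]
      exact_mod_cast h
    intro l hl
    have := (Finset.sum_eq_zero_iff_of_nonneg fun l _ =>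
      mul_nonneg (Nat.cast_nonneg _) (Complex.normSq_nonneg _)).mp key l hl
    rcases mul_eq_zero.mp this with h | h
    · exact absurd h (by positivity)
    · exact Complex.normSq_eq_zero.mp h

noncomputable instance (m : ℕ) : NormedAddCommGroup (BinaryForm m) :=
  (core m).toNormedAddCommGroup

noncomputable instance (m : ℕ) : InnerProductSpace ℂ (BinaryForm m) :=
  InnerProductSpace.ofCore (core m).toCore

instance (m : ℕ) : CompleteSpace (BinaryForm m) :=
  FiniteDimensional.complete ℂ (BinaryForm m)

end BinaryForm

/-! ### The representations of `SU(2)` -/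

/-- The group `SU(2)`. -/
abbrev SU2 : Type := Matrix.specialUnitaryGroup (Fin 2) ℂ

/-- The substitution `f(x₁, x₂) ↦ f((x₁, x₂) g)` in the polynomial ring, where `(x₁, x₂) g` is
the product of a row vector with a matrix. -/
noncomputable def subst (g : Matrix (Fin 2) (Fin 2) ℂ) :
    MvPolynomial (Fin 2) ℂ →ₐ[ℂ] MvPolynomial (Fin 2) ℂ :=
  aeval fun j => ∑ i, X i * C (g i j)

theorem subst_isHomogeneous (g : Matrix (Fin 2) (Fin 2) ℂ) {m : ℕ}
    {f : MvPolynomial (Fin 2) ℂ} (hf : f.IsHomogeneous m) : (subst g f).IsHomogeneous m := by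
  have h : ∀ j : Fin 2, (∑ i, X i * C (g i j) : MvPolynomial (Fin 2) ℂ).IsHomogeneous 1 :=
    fun j => IsHomogeneous.sum _ _ _ fun i _ =>
      (isHomogeneous_X ℂ i).mul (isHomogeneous_C (Fin 2) (g i j))
  have h2 := hf.aeval _ h
  rw [one_mul] at h2
  exact h2

theorem subst_one (f : MvPolynomial (Fin 2) ℂ) : subst 1 f = f := by
  have : subst 1 = AlgHom.id ℂ (MvPolynomial (Fin 2) ℂ) := by
    ext1 j
    simp [subst, Matrix.one_apply]
  rw [this, AlgHom.id_apply]

theorem subst_mul (g h : Matrix (Fin 2) (Fin 2) ℂ) (f : MvPolynomial (Fin 2) ℂ) :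
    subst (g * h) f = subst g (subst h f) := by
  have : subst (g * h) = (subst g).comp (subst h) := by
    ext1 j
    simp [subst, Matrix.mul_apply, Fin.sum_univ_two, algebraMap_eq]
    ring
  rw [this, AlgHom.comp_apply]

/-- The representation `ρ_m` of `SU(2)` on `P_m`, `(ρ_m(g) f)(x₁, x₂) = f((x₁, x₂) g)`. -/
noncomputable def rho (m : ℕ) : Representation ℂ SU2 (BinaryForm m) where
  toFun g :=
    { toFun := fun f => BinaryForm.ofPoly (subst g.1 (BinaryForm.toPoly m f))
        (subst_isHomogeneous g.1 (BinaryForm.toPoly_isHomogeneous f))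
      map_add' := fun f f' => BinaryForm.toPoly_injective m (by simp)
      map_smul' := fun c f => BinaryForm.toPoly_injective m (by simp) }
  map_one' := LinearMap.ext fun f =>
    BinaryForm.toPoly_injective m (subst_one (BinaryForm.toPoly m f))
  map_mul' g h := LinearMap.ext fun f =>
    BinaryForm.toPoly_injective m (subst_mul g.1 h.1 (BinaryForm.toPoly m f))

/-! ### Quantum channels and covariance -/

section Channels

variable {H K : Type*} [NormedAddCommGroup H] [InnerProductSpace ℂ H] [FiniteDimensional ℂ H]
  [CompleteSpace H] [NormedAddCommGroup K] [InnerProductSpace ℂ K] [FiniteDimensional ℂ K]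
  [CompleteSpace K]

/-- A linear map `Φ : End(H) → End(K)`, for finite-dimensional Hilbert spaces `H` and `K`, is
completely positive if it is so as a map between the C⋆-algebras of (automatically continuous)
linear operators on `H` and on `K`: for every `k`, applying `Φ` to the entries of a positive
`k × k` matrix over `End(H)` gives a positive matrix over `End(K)`. -/
def IsCompletelyPositive (Φ : (H →ₗ[ℂ] H) →ₗ[ℂ] (K →ₗ[ℂ] K)) : Prop :=
  ∃ Ψ : (H →L[ℂ] H) →CP (K →L[ℂ] K), ∀ A : H →ₗ[ℂ] H,
    Ψ (LinearMap.toContinuousLinearMap A) = LinearMap.toContinuousLinearMap (Φ A)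

/-- A quantum channel is a completely positive trace-preserving linear map `End(H) → End(K)`. -/
structure IsQuantumChannel (Φ : (H →ₗ[ℂ] H) →ₗ[ℂ] (K →ₗ[ℂ] K)) : Prop where
  completelyPositive : IsCompletelyPositive Φ
  trace_preserving : ∀ A : H →ₗ[ℂ] H, LinearMap.trace ℂ K (Φ A) = LinearMap.trace ℂ H A

end Channels

/-- `Φ : End(H) → End(K)` is `G`-equivariant for the representations
`A ↦ π(g) A π(g⁻¹)` of `G` on `End(H)` and `End(K)`. -/
def IsEquivariant {G H K : Type*} [Group G] [AddCommGroup H] [Module ℂ H] [AddCommGroup K]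
    [Module ℂ K] (π : Representation ℂ G H) (σ : Representation ℂ G K)
    (Φ : (H →ₗ[ℂ] H) →ₗ[ℂ] (K →ₗ[ℂ] K)) : Prop :=
  (π.linHom π).IsIntertwiningMap (σ.linHom σ) Φ

/-- A `G`-irreducibly covariant channel with respect to representations `π` on `H` and `σ` on `K`:
a quantum channel that is `G`-equivariant, where both `π` and `σ` are irreducible. -/
structure IsIrreduciblyCovariantChannel {G H K : Type*} [Group G]
    [NormedAddCommGroup H] [InnerProductSpace ℂ H] [FiniteDimensional ℂ H] [CompleteSpace H]
    [NormedAddCommGroup K] [InnerProductSpace ℂ K] [FiniteDimensional ℂ K] [CompleteSpace K]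
    (π : Representation ℂ G H) (σ : Representation ℂ G K)
    (Φ : (H →ₗ[ℂ] H) →ₗ[ℂ] (K →ₗ[ℂ] K)) : Prop where
  channel : IsQuantumChannel Φ
  equivariant : IsEquivariant π σ Φ
  irreducible_source : π.IsIrreducible
  irreducible_target : σ.IsIrreducible

end SU2Covariant

/-! By Schur's lemma the functional `A ↦ tr (Φ A)`, being conjugation-invariant on an irreducible
representation, is `c • tr`, and positivity of `Φ` forces `c ≥ 0`. If `c > 0`, then `c⁻¹ • Φ` is a
channel. If `c = 0`, then `Φ` sends positive operators to positive operators of trace zero, so it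
vanishes, and any covariant channel will do; the completely depolarizing channel always exists.

The representation `ρ_m` is irreducible because the monomials are eigenvectors, with pairwise
distinct eigenvalues, of a diagonal element of `SU(2)`, while a rotation by a generic angle has
only nonzero matrix entries in the row and in the column of `x₁ ^ m`. -/

namespace SU2Covariant

open scoped ComplexOrder ComplexConjugate

section Schur

variable {k G V : Type*} [Field k] [AddCommGroup V] [Module k V]

theorem nontrivial_of_isIrreducible [Monoid G] (π : Representation k G V) [π.IsIrreducible] :
    Nontrivial V :=
  IsSimpleModule.nontrivial (MonoidAlgebra k G) π.asModule

theorem exists_eq_smul_one_of_isIntertwiningMap [IsAlgClosed k] [FiniteDimensional k V] [Monoid G]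
    (π : Representation k G V) [π.IsIrreducible] {X : Module.End k V}
    (hX : π.IsIntertwiningMap π X) : ∃ c : k, X = c • 1 := by
  obtain ⟨c, hc⟩ :=
    (Representation.IsIrreducible.algebraMap_intertwiningMap_bijective_of_isAlgClosed
      (k := k) (ρ := π)).surjective (X.intertwiningMap_of_isIntertwiningMap π π hX.isIntertwining)
  rw [Algebra.algebraMap_eq_smul_one] at hc
  exact ⟨c, LinearMap.ext fun v => (congr($hc v)).symm⟩

theorem trace_linHom_apply [Group G] (π : Representation k G V) (g : G) (A : Module.End k V) :
    LinearMap.trace k V (π.linHom π g A) = LinearMap.trace k V A := by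
  rw [Representation.linHom_apply, ← Module.End.mul_eq_comp, ← Module.End.mul_eq_comp,
    ← mul_assoc, LinearMap.trace_mul_cycle, ← map_mul, inv_mul_cancel, map_one, one_mul]

variable [FiniteDimensional k V]

theorem eq_zero_of_trace_mul_eq_zero {X : Module.End k V}
    (hX : ∀ A, LinearMap.trace k V (X * A) = 0) : X = 0 := by
  refine LinearMap.ext fun v => (Module.forall_dual_apply_eq_zero_iff k _).1 fun f => ?_
  have hrank_one : X * f.smulRight v = f.smulRight (X v) := by ext; simp
  rw [← LinearMap.trace_smulRight, ← hrank_one, hX]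

theorem exists_trace_mul_eq (F : Module.Dual k (Module.End k V)) :
    ∃ X : Module.End k V, ∀ A, LinearMap.trace k V (X * A) = F A := by
  let traceForm : Module.End k V →ₗ[k] Module.Dual k (Module.End k V) :=
    (LinearMap.mul k (Module.End k V)).compr₂ (LinearMap.trace k V)
  have hinj : Function.Injective traceForm :=
    (injective_iff_map_eq_zero traceForm).2 fun X hX =>
      eq_zero_of_trace_mul_eq_zero fun A => congr($hX A)
  obtain ⟨X, hX⟩ := (LinearMap.injective_iff_surjective_of_finrank_eq_finrank
    Subspace.dual_finrank_eq.symm).1 hinj F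
  exact ⟨X, fun A => congr($hX A)⟩

theorem exists_eq_smul_trace [IsAlgClosed k] [Group G] (π : Representation k G V)
    [π.IsIrreducible] {F : Module.Dual k (Module.End k V)}
    (hF : ∀ g A, F (π.linHom π g A) = F A) : ∃ c : k, F = c • LinearMap.trace k V := by
  obtain ⟨X, hX⟩ := exists_trace_mul_eq F
  have hconj (g : G) : π g ∘ₗ X ∘ₗ π g⁻¹ = X := by
    refine sub_eq_zero.1 (eq_zero_of_trace_mul_eq_zero fun A => ?_)
    have hcycle : LinearMap.trace k V ((π g ∘ₗ X ∘ₗ π g⁻¹) * A) =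
        LinearMap.trace k V (X * π.linHom π g⁻¹ A) := by
      rw [Representation.linHom_apply, inv_inv]
      exact LinearMap.trace_mul_comm k (π g) (X * π g⁻¹ * A)
    rw [sub_mul, map_sub, hcycle, hX, hX, hF, sub_self]
  obtain ⟨c, rfl⟩ := exists_eq_smul_one_of_isIntertwiningMap π
    ((Representation.mem_linHom_invariants_iff_isIntertwining X).1 hconj)
  exact ⟨c, LinearMap.ext fun A => by rw [← hX, smul_one_mul, map_smul, LinearMap.smul_apply]⟩

end Schur

namespace IsEquivariant

variable {G H K : Type*} [Group G] [AddCommGroup H] [Module ℂ H] [AddCommGroup K] [Module ℂ K]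
  {π : Representation ℂ G H} {σ : Representation ℂ G K} {Φ : (H →ₗ[ℂ] H) →ₗ[ℂ] (K →ₗ[ℂ] K)}

theorem smul (hΦ : IsEquivariant π σ Φ) (c : ℂ) : IsEquivariant π σ (c • Φ) :=
  ⟨fun g A => by rw [LinearMap.smul_apply, hΦ.isIntertwining, LinearMap.smul_apply, map_smul]⟩

theorem exists_trace_comp_eq_smul_trace [FiniteDimensional ℂ H] [π.IsIrreducible]
    (hΦ : IsEquivariant π σ Φ) :
    ∃ c : ℂ, LinearMap.trace ℂ K ∘ₗ Φ = c • LinearMap.trace ℂ H :=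
  exists_eq_smul_trace π fun g A => by
    rw [LinearMap.comp_apply, hΦ.isIntertwining, trace_linHom_apply, LinearMap.comp_apply]

end IsEquivariant

section CompletelyPositive

theorem eq_zero_of_isPositive_of_trace_eq_zero {𝕜 E : Type*} [RCLike 𝕜] [NormedAddCommGroup E]
    [InnerProductSpace 𝕜 E] [FiniteDimensional 𝕜 E] {A : E →ₗ[𝕜] E} (hA : A.IsPositive)
    (htr : LinearMap.trace 𝕜 E A = 0) : A = 0 := by
  let b := (stdOrthonormalBasis 𝕜 E).toBasis
  have hpos : (A.toMatrix b b).PosSemidef :=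
    (LinearMap.posSemidef_toMatrix_iff (stdOrthonormalBasis 𝕜 E)).2 hA
  rw [LinearMap.trace_eq_matrix_trace 𝕜 b, hpos.trace_eq_zero_iff] at htr
  exact (LinearMap.toMatrix b b).map_eq_zero_iff.1 htr

variable {H K : Type*} [NormedAddCommGroup H] [InnerProductSpace ℂ H] [FiniteDimensional ℂ H]
  [CompleteSpace H] [NormedAddCommGroup K] [InnerProductSpace ℂ K] [FiniteDimensional ℂ K]
  [CompleteSpace K]

theorem span_setOf_isPositive : Submodule.span ℂ {A : H →ₗ[ℂ] H | A.IsPositive} = ⊤ := by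
  let e := LinearMap.toContinuousLinearMap (𝕜 := ℂ) (E := H) (F' := H)
  have hpre : {A : H →ₗ[ℂ] H | A.IsPositive} = e.symm '' {B : H →L[ℂ] H | 0 ≤ B} := by
    rw [LinearEquiv.image_symm_eq_preimage]
    ext A
    rw [Set.mem_preimage, Set.mem_ofPred_eq, Set.mem_ofPred_eq,
      ContinuousLinearMap.nonneg_iff_isPositive, LinearMap.isPositive_toContinuousLinearMap_iff]
  rw [hpre, ← LinearEquiv.coe_coe, Submodule.span_image, CStarAlgebra.span_nonneg,
    Submodule.map_top, LinearEquiv.range]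

namespace IsCompletelyPositive

variable {Φ : (H →ₗ[ℂ] H) →ₗ[ℂ] (K →ₗ[ℂ] K)}

theorem isPositive (hΦ : IsCompletelyPositive Φ) {A : H →ₗ[ℂ] H} (hA : A.IsPositive) :
    (Φ A).IsPositive := by
  obtain ⟨Ψ, hΨ⟩ := hΦ
  rw [← LinearMap.isPositive_toContinuousLinearMap_iff,
    ← ContinuousLinearMap.nonneg_iff_isPositive] at hA ⊢
  rw [← hΨ]
  exact map_nonneg Ψ hA

theorem smul (hΦ : IsCompletelyPositive Φ) {c : ℝ} (hc : 0 ≤ c) :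
    IsCompletelyPositive ((c : ℂ) • Φ) := by
  obtain ⟨Ψ, hΨ⟩ := hΦ
  have hcP : ∀ k (M : CStarMatrix (Fin k) (Fin k) (H →L[ℂ] H)), 0 ≤ M →
      0 ≤ M.map ((c : ℂ) • Ψ.toLinearMap) := fun k M hM =>
    smul_nonneg (Complex.zero_le_real.2 hc) (Ψ.map_cstarMatrix_nonneg' k M hM)
  exact ⟨⟨(c : ℂ) • Ψ.toLinearMap, hcP⟩, fun A => congr((c : ℂ) • $(hΨ A))⟩

theorem eq_zero_of_trace_comp_eq_zero (hΦ : IsCompletelyPositive Φ)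
    (htr : LinearMap.trace ℂ K ∘ₗ Φ = 0) : Φ = 0 :=
  LinearMap.ext_on span_setOf_isPositive fun A hA =>
    eq_zero_of_isPositive_of_trace_eq_zero (hΦ.isPositive hA) congr($htr A)

theorem nonneg_of_trace_comp_eq_smul_trace [Nontrivial H] (hΦ : IsCompletelyPositive Φ) {c : ℂ}
    (htr : LinearMap.trace ℂ K ∘ₗ Φ = c • LinearMap.trace ℂ H) : 0 ≤ c := by
  have htr_one : LinearMap.trace ℂ K (Φ 1) = c * Module.finrank ℂ H := by
    simpa using congr($htr 1)
  have hdim : (0 : ℂ) < Module.finrank ℂ H := by exact_mod_cast Module.finrank_pos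
  refine le_of_mul_le_mul_right ?_ hdim
  rw [zero_mul, ← htr_one]
  exact (hΦ.isPositive LinearMap.isPositive_one).trace_nonneg

theorem isQuantumChannel_inv_smul (hΦ : IsCompletelyPositive Φ) {c : ℝ} (hc : 0 < c)
    (htr : LinearMap.trace ℂ K ∘ₗ Φ = (c : ℂ) • LinearMap.trace ℂ H) :
    IsQuantumChannel ((c : ℂ)⁻¹ • Φ) where
  completelyPositive := by
    rw [← Complex.ofReal_inv]
    exact hΦ.smul (inv_nonneg.2 hc.le)
  trace_preserving A := by
    have htrA : LinearMap.trace ℂ K (Φ A) = c * LinearMap.trace ℂ H A := congr($htr A)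
    rw [LinearMap.smul_apply, map_smul, htrA, smul_eq_mul,
      inv_mul_cancel_left₀ (Complex.ofReal_ne_zero.2 hc.ne')]

end IsCompletelyPositive

end CompletelyPositive

section Depolarizing

open scoped MatrixOrder in
theorem ofMatrix_map_algebraMap_nonneg {A n : Type*} [CStarAlgebra A] [PartialOrder A]
    [StarOrderedRing A] [Fintype n] {M : Matrix n n ℂ} (hM : M.PosSemidef) :
    0 ≤ CStarMatrix.ofMatrix (M.map (algebraMap ℂ A)) := by
  have hM' : 0 ≤ CStarMatrix.ofMatrixStarAlgEquiv M := map_nonneg _ hM.nonneg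
  exact map_nonneg (CStarMatrix.mapₙₐ (StarAlgHom.ofId ℂ A : ℂ →⋆ₙₐ[ℂ] A)) hM'

/- Stated for an abstract C⋆-algebra because the real-algebra instances that
`CStarAlgebra.nonneg_iff_eq_star_mul_self` needs are not found directly for `CStarMatrix`. -/
theorem exists_eq_star_mul_self_of_nonneg {A : Type*} [NonUnitalCStarAlgebra A] [PartialOrder A]
    [StarOrderedRing A] {a : A} (ha : 0 ≤ a) : ∃ s, a = star s * s :=
  CStarAlgebra.nonneg_iff_eq_star_mul_self.1 ha

theorem posSemidef_trace_of_nonneg {H n : Type*} [NormedAddCommGroup H] [InnerProductSpace ℂ H]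
    [FiniteDimensional ℂ H] [CompleteSpace H] [Fintype n] {M : CStarMatrix n n (H →L[ℂ] H)}
    (hM : 0 ≤ M) : (Matrix.of fun p q => LinearMap.trace ℂ H (M p q)).PosSemidef := by
  obtain ⟨N, rfl⟩ := exists_eq_star_mul_self_of_nonneg hM
  let b := stdOrthonormalBasis ℂ H
  have hgram : (Matrix.of fun p q => LinearMap.trace ℂ H ((star N * N) p q)) =
      ∑ i, ∑ d, Matrix.gram ℂ fun p => N d p (b i) := by
    ext p q
    simp_rw [Matrix.of_apply, Matrix.sum_apply, Matrix.gram_apply, LinearMap.trace_eq_sum_inner _ b,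
      CStarMatrix.mul_apply, CStarMatrix.star_apply, ContinuousLinearMap.star_eq_adjoint]
    simp [inner_sum, ContinuousLinearMap.adjoint_inner_right]
  rw [hgram]
  exact Matrix.posSemidef_sum _ fun i _ => Matrix.posSemidef_sum _ fun d _ =>
    Matrix.posSemidef_gram ℂ _

/-- The completely depolarizing channel `A ↦ (tr A / dim K) • 1` from `End(H)` to `End(K)`. -/
noncomputable def depolarizing (H K : Type*) [AddCommGroup H] [Module ℂ H] [AddCommGroup K]
    [Module ℂ K] : (H →ₗ[ℂ] H) →ₗ[ℂ] (K →ₗ[ℂ] K) :=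
  (Module.finrank ℂ K : ℂ)⁻¹ • (LinearMap.trace ℂ H).smulRight LinearMap.id

theorem isEquivariant_depolarizing {G H K : Type*} [Group G] [AddCommGroup H] [Module ℂ H]
    [AddCommGroup K] [Module ℂ K] (π : Representation ℂ G H) (σ : Representation ℂ G K) :
    IsEquivariant π σ (depolarizing H K) := by
  have hunit (g : G) : σ.linHom σ g 1 = 1 := by
    rw [Representation.linHom_apply, Module.End.one_eq_id, LinearMap.id_comp,
      ← Module.End.mul_eq_comp, ← map_mul, mul_inv_cancel, map_one, Module.End.one_eq_id]
  refine IsEquivariant.smul ⟨fun g A => ?_⟩ _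
  rw [LinearMap.smulRight_apply, LinearMap.smulRight_apply, trace_linHom_apply, map_smul,
    ← Module.End.one_eq_id, hunit]

variable {H K : Type*} [NormedAddCommGroup H] [InnerProductSpace ℂ H] [FiniteDimensional ℂ H]
  [CompleteSpace H] [NormedAddCommGroup K] [InnerProductSpace ℂ K] [FiniteDimensional ℂ K]
  [CompleteSpace K]

theorem isCompletelyPositive_trace_smulRight_id :
    IsCompletelyPositive ((LinearMap.trace ℂ H).smulRight (LinearMap.id : K →ₗ[ℂ] K)) := by
  let Ψ : (H →L[ℂ] H) →ₗ[ℂ] (K →L[ℂ] K) :=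
    (LinearMap.trace ℂ H ∘ₗ ContinuousLinearMap.coeLM ℂ).smulRight 1
  have hmap {k : ℕ} (M : CStarMatrix (Fin k) (Fin k) (H →L[ℂ] H)) :
      M.map Ψ = CStarMatrix.ofMatrix
        ((Matrix.of fun p q => LinearMap.trace ℂ H (M p q)).map (algebraMap ℂ (K →L[ℂ] K))) :=
    CStarMatrix.ext fun p q =>
      (Algebra.algebraMap_eq_smul_one (LinearMap.trace ℂ H (M p q))).symm
  exact ⟨⟨Ψ, fun k M hM =>
    hmap M ▸ ofMatrix_map_algebraMap_nonneg (posSemidef_trace_of_nonneg hM)⟩, fun A => rfl⟩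

theorem isQuantumChannel_depolarizing [Nontrivial K] : IsQuantumChannel (depolarizing H K) where
  completelyPositive := by
    rw [depolarizing, ← Complex.ofReal_natCast, ← Complex.ofReal_inv]
    exact isCompletelyPositive_trace_smulRight_id.smul (inv_nonneg.2 (Nat.cast_nonneg _))
  trace_preserving A := by
    have hdim : (Module.finrank ℂ K : ℂ) ≠ 0 := Nat.cast_ne_zero.2 Module.finrank_pos.ne'
    rw [depolarizing, LinearMap.smul_apply, LinearMap.smulRight_apply, map_smul, map_smul,
      LinearMap.trace_id, smul_eq_mul, smul_eq_mul]
    field_simp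

end Depolarizing

section Weights

variable {k V ι : Type*} [Field k] [AddCommGroup V] [Module k V] (b : Module.Basis ι k V)

theorem basis_mem_of_repr_ne_zero {T : Module.End k V} {c : ι → k} (hc : Function.Injective c)
    (hT : ∀ i, T (b i) = c i • b i) {W : Submodule k V} (hW : W ≤ W.comap T) {v : V}
    (hv : v ∈ W) {i : ι} (hi : b.repr v i ≠ 0) : b i ∈ W := by
  classical
  let q := Lagrange.basis (b.repr v).support c i
  have hq (j : ι) : Polynomial.aeval T q (b j) = q.eval (c j) • b j :=
    Module.End.aeval_apply_of_mem_apply_eq_smul (hT j)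
  have hproj : Polynomial.aeval T q v = b.repr v i • b i := by
    conv_lhs => rw [← b.linearCombination_repr v, Finsupp.linearCombination_apply, Finsupp.sum]
    rw [map_sum, Finset.sum_eq_single i]
    · rw [map_smul, hq, Lagrange.eval_basis_self hc.injOn (Finsupp.mem_support_iff.2 hi), one_smul]
    · intro j hj hji
      rw [map_smul, hq, Lagrange.eval_basis_of_ne hji.symm hj, zero_smul, smul_zero]
    · exact fun h => absurd (Finsupp.mem_support_iff.2 hi) h
  have hmem : Polynomial.aeval T q v ∈ W := Polynomial.aeval_apply_smul_mem_of_le_comap hv q T hW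
  rwa [hproj, W.smul_mem_iff hi] at hmem

theorem isIrreducible_of_simple_spectrum {G : Type*} [Monoid G] {ρ : Representation k G V}
    {t : G} {c : ι → k} (hc : Function.Injective c) (ht : ∀ i, ρ t (b i) = c i • b i) (i₀ : ι)
    (hto : ∀ i, ∃ g, b.repr (ρ g (b i)) i₀ ≠ 0) (hfrom : ∀ i, ∃ g, b.repr (ρ g (b i₀)) i ≠ 0) :
    ρ.IsIrreducible := by
  have hmem (W : Subrepresentation ρ) {v : V} (hv : v ∈ W.toSubmodule) {i : ι}
      (hi : b.repr v i ≠ 0) : b i ∈ W.toSubmodule :=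
    basis_mem_of_repr_ne_zero b hc ht (fun _ => (W.apply_mem_toSubmodule t ·)) hv hi
  have htop (W : Subrepresentation ρ) {v : V} (hv : v ∈ W.toSubmodule) (hv0 : v ≠ 0) :
      W.toSubmodule = ⊤ := by
    obtain ⟨i, hi⟩ := Finsupp.ne_iff.1 (b.repr.map_ne_zero_iff.2 hv0)
    obtain ⟨g, hg⟩ := hto i
    have hbase : b i₀ ∈ W.toSubmodule := hmem W (W.apply_mem_toSubmodule g (hmem W hv hi)) hg
    rw [eq_top_iff, ← b.span_eq, Submodule.span_le]
    rintro _ ⟨j, rfl⟩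
    obtain ⟨h, hh⟩ := hfrom j
    exact hmem W (W.apply_mem_toSubmodule h hbase) hh
  have : Nontrivial V := ⟨b i₀, 0, b.ne_zero i₀⟩
  refine { exists_pair_ne := ⟨⊥, ⊤, fun h => ?_⟩, eq_bot_or_eq_top := fun W => ?_ }
  · exact bot_ne_top (α := Submodule k V) congr(($h).toSubmodule)
  · by_cases hW : W.toSubmodule = ⊥
    · exact Or.inl (Subrepresentation.toSubmodule_injective hW)
    · obtain ⟨v, hv, hv0⟩ := W.toSubmodule.ne_bot_iff.1 hW
      exact Or.inr (Subrepresentation.toSubmodule_injective (htop W hv hv0))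

end Weights

theorem injective_pow_mul_pow_of_isPrimitiveRoot {R : Type*} [CommMonoid R] {m : ℕ} {u v : R}
    (huv : u * v = 1) (hu : IsPrimitiveRoot u (2 * (m + 1))) :
    Function.Injective fun l : Fin (m + 1) => u ^ (l : ℕ) * v ^ (m - l : ℕ) := by
  have hshift (l : Fin (m + 1)) :
      u ^ m * (u ^ (l : ℕ) * v ^ (m - l : ℕ)) = u ^ (2 * l : ℕ) := by
    have hm : u ^ m = u ^ (l : ℕ) * u ^ (m - l : ℕ) := by
      rw [← pow_add, Nat.add_sub_cancel' l.is_le]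
    rw [hm, mul_mul_mul_comm, ← mul_pow u v, huv, one_pow, mul_one, ← pow_add, two_mul]
  intro l j hlj
  have hpow : u ^ (2 * l : ℕ) = u ^ (2 * j : ℕ) := by
    rw [← hshift, ← hshift]
    exact congr(u ^ m * $hlj)
  have := hu.pow_inj (by omega) (by omega) hpow
  omega

section BinaryForms

open MvPolynomial BinaryForm

namespace BinaryForm

variable {m : ℕ}

/-- The monomial `x₁ ^ l * x₂ ^ (m - l)`, as an element of `P_m`. -/
noncomputable def mono (l : Fin (m + 1)) : BinaryForm m :=
  ofPoly (X 0 ^ (l : ℕ) * X 1 ^ (m - l : ℕ)) (by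
    simpa only [Nat.add_sub_cancel' l.is_le] using
      (isHomogeneous_X_pow (R := ℂ) (0 : Fin 2) (l : ℕ)).mul (isHomogeneous_X_pow 1 (m - l : ℕ)))

theorem toPoly_mono (l : Fin (m + 1)) :
    toPoly m (mono l) = X 0 ^ (l : ℕ) * X 1 ^ (m - l : ℕ) :=
  rfl

theorem coef_mono (l : Fin (m + 1)) (j : ℕ) : coef j (mono l) = if (l : ℕ) = j then 1 else 0 := by
  have hexpo : expo m l = expo m j ↔ (l : ℕ) = j :=
    ⟨fun h => by simpa [expo] using congr($h 0), fun h => congr(expo m $h)⟩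
  rw [coef, toPoly_mono, X_pow_eq_monomial, X_pow_eq_monomial, monomial_mul, one_mul, ← expo,
    coeff_monomial, if_congr hexpo rfl rfl]

theorem coef_sum_smul_mono (a : Fin (m + 1) → ℂ) (l : Fin (m + 1)) :
    coef l (∑ j, a j • mono j) = a l := by
  have hcoef (j : Fin (m + 1)) : coeff (expo m l) (toPoly m (mono j)) = if j = l then 1 else 0 := by
    simp only [Fin.ext_iff, ← coef_mono, coef]
  simp [coef, coeff_sum, hcoef]

theorem sum_coef_smul_mono (f : BinaryForm m) : ∑ l : Fin (m + 1), coef l f • mono l = f := by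
  rw [← sub_eq_zero]
  refine eq_zero_of_coef fun l hl => ?_
  have hsum := coef_sum_smul_mono (fun j => coef j f) ⟨l, Finset.mem_range.1 hl⟩
  rw [coef] at hsum ⊢
  rw [map_sub, coeff_sub, hsum, coef, sub_self]

/-- The basis of monomials of `P_m`, whose coordinates are the coefficients `coef l`. -/
noncomputable def monoBasis (m : ℕ) : Module.Basis (Fin (m + 1)) ℂ (BinaryForm m) :=
  .ofEquivFun
    { toFun := fun f l => coef l f
      map_add' := fun f g => by ext; simp [coef]
      map_smul' := fun c f => by ext; simp [coef]
      invFun := fun a => ∑ l, a l • mono l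
      left_inv := sum_coef_smul_mono
      right_inv := fun a => funext (coef_sum_smul_mono a) }

theorem monoBasis_repr_apply (f : BinaryForm m) (l : Fin (m + 1)) :
    (monoBasis m).repr f l = coef l f :=
  rfl

theorem monoBasis_apply (l : Fin (m + 1)) : monoBasis m l = mono l := by
  rw [Module.Basis.apply_eq_iff]
  ext j
  rw [monoBasis_repr_apply, coef_mono, Finsupp.single_apply]
  exact if_congr Fin.ext_iff.symm rfl rfl

theorem coef_self_eq_eval (f : BinaryForm m) : coef m f = eval ![1, 0] (toPoly m f) := by
  have heq : (monoBasis m).coord (Fin.last m) =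
      (aeval (R := ℂ) ![1, 0]).toLinearMap ∘ₗ toPoly m := by
    refine (monoBasis m).ext fun l => ?_
    have hl : m - (l : ℕ) = 0 ↔ (l : ℕ) = m := by omega
    rw [Module.Basis.coord_apply, monoBasis_repr_apply, monoBasis_apply, Fin.val_last, coef_mono]
    simp [toPoly_mono, zero_pow_eq, hl]
  exact congr($heq f)

end BinaryForm

variable {m : ℕ} (g : SU2)

theorem toPoly_rho (f : BinaryForm m) : toPoly m (rho m g f) = subst g.1 (toPoly m f) :=
  rfl

theorem subst_X (g : Matrix (Fin 2) (Fin 2) ℂ) (j : Fin 2) :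
    subst g (X j) = g 0 j • X 0 + g 1 j • X 1 := by
  rw [subst, aeval_X, Fin.sum_univ_two, smul_eq_C_mul, smul_eq_C_mul, mul_comm, mul_comm (X 1)]

theorem toPoly_rho_mono (l : Fin (m + 1)) :
    toPoly m (rho m g (mono l)) =
      (g.1 0 0 • X 0 + g.1 1 0 • X 1) ^ (l : ℕ) *
        (g.1 0 1 • X 0 + g.1 1 1 • X 1) ^ (m - l : ℕ) := by
  rw [toPoly_rho, toPoly_mono, map_mul, map_pow, map_pow, subst_X, subst_X]

variable {g} in
theorem rho_mono_of_diagonal (h01 : g.1 0 1 = 0) (h10 : g.1 1 0 = 0) (l : Fin (m + 1)) :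
    rho m g (mono l) = (g.1 0 0 ^ (l : ℕ) * g.1 1 1 ^ (m - l : ℕ)) • mono l := by
  refine toPoly_injective m ?_
  rw [toPoly_rho_mono, h01, h10, zero_smul, zero_smul, add_zero, zero_add, smul_pow, smul_pow,
    smul_mul_smul_comm, map_smul, toPoly_mono]

theorem coef_self_rho_mono (l : Fin (m + 1)) :
    coef m (rho m g (mono l)) = g.1 0 0 ^ (l : ℕ) * g.1 0 1 ^ (m - l : ℕ) := by
  rw [coef_self_eq_eval, toPoly_rho_mono]
  simp [smul_eval]

theorem coef_rho_mono_last (l : Fin (m + 1)) :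
    coef l (rho m g (mono (Fin.last m))) =
      g.1 0 0 ^ (l : ℕ) * g.1 1 0 ^ (m - l : ℕ) * m.choose l := by
  have hbinom : rho m g (mono (Fin.last m)) =
      ∑ j : Fin (m + 1), (g.1 0 0 ^ (j : ℕ) * g.1 1 0 ^ (m - j : ℕ) * m.choose j) • mono j := by
    refine toPoly_injective m ?_
    rw [toPoly_rho_mono, Fin.val_last, Nat.sub_self, pow_zero, mul_one, add_pow, Finset.sum_range,
      map_sum]
    refine Finset.sum_congr rfl fun j _ => ?_
    rw [map_smul, toPoly_mono, smul_pow, smul_pow, smul_mul_smul_comm, smul_mul_assoc,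
      ← nsmul_eq_mul', ← Nat.cast_smul_eq_nsmul ℂ, smul_smul]
  rw [hbinom, coef_sum_smul_mono]

/-- The element of `SU(2)` with Cayley–Klein parameters `a` and `b`. -/
noncomputable def ofCayleyKlein (a b : ℂ) (h : ‖a‖ ^ 2 + ‖b‖ ^ 2 = 1) : SU2 :=
  ⟨!![a, -conj b; b, conj a], by
    have hab : a * conj a + b * conj b = 1 := by
      rw [Complex.mul_conj', Complex.mul_conj']
      exact_mod_cast h
    have hdet : !![a, -conj b; b, conj a].det = 1 := by
      rw [Matrix.det_fin_two_of]
      linear_combination hab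
    have hstar : star !![a, -conj b; b, conj a] = !![a, -conj b; b, conj a].adjugate := by
      rw [Matrix.adjugate_fin_two_of]
      ext i j
      fin_cases i <;> fin_cases j <;> simp
    refine Matrix.mem_specialUnitaryGroup_iff.2 ⟨Matrix.mem_unitaryGroup_iff'.2 ?_, hdet⟩
    rw [hstar, Matrix.adjugate_mul, hdet, one_smul]⟩

theorem rho_isIrreducible (m : ℕ) : (rho m).IsIrreducible := by
  let u := Complex.exp (2 * Real.pi * Complex.I / (2 * (m + 1) : ℕ))
  have hprim : IsPrimitiveRoot u (2 * (m + 1)) := Complex.isPrimitiveRoot_exp _ (by positivity)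
  have hu : ‖u‖ = 1 := hprim.norm'_eq_one (by positivity)
  let torus : SU2 := ofCayleyKlein u 0 (by simp [hu])
  let rotation : SU2 := ofCayleyKlein (3 / 5) (4 / 5) (by norm_num)
  have huconj : u * conj u = 1 := by rw [Complex.mul_conj', hu]; norm_num
  have hdiag (l : Fin (m + 1)) :
      rho m torus (monoBasis m l) = (u ^ (l : ℕ) * conj u ^ (m - l : ℕ)) • monoBasis m l := by
    rw [monoBasis_apply]
    exact rho_mono_of_diagonal (by simp [torus, ofCayleyKlein]) rfl l
  refine isIrreducible_of_simple_spectrum (monoBasis m)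
    (injective_pow_mul_pow_of_isPrimitiveRoot huconj hprim) hdiag (Fin.last m)
    (fun l => ⟨rotation, ?_⟩) (fun l => ⟨rotation, ?_⟩)
  · rw [monoBasis_repr_apply, monoBasis_apply, Fin.val_last, coef_self_rho_mono]
    simp [rotation, ofCayleyKlein]
  · rw [monoBasis_repr_apply, monoBasis_apply, coef_rho_mono_last]
    simp [rotation, ofCayleyKlein, (Nat.choose_pos l.is_le).ne']

end BinaryForms
end SU2Covariant

open SU2Covariant in
theorem corollary4p2_general {G H K : Type*} [Group G]
    [NormedAddCommGroup H] [InnerProductSpace ℂ H] [FiniteDimensional ℂ H] [CompleteSpace H]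
    [NormedAddCommGroup K] [InnerProductSpace ℂ K] [FiniteDimensional ℂ K] [CompleteSpace K]
    (π : Representation ℂ G H) (σ : Representation ℂ G K)
    [hπ : π.IsIrreducible] [hσ : σ.IsIrreducible] {Φ : (H →ₗ[ℂ] H) →ₗ[ℂ] (K →ₗ[ℂ] K)}
    (hCP : IsCompletelyPositive Φ) (hEq : IsEquivariant π σ Φ) :
    ∃ c : ℝ, 0 ≤ c ∧ ∃ Ψ : (H →ₗ[ℂ] H) →ₗ[ℂ] (K →ₗ[ℂ] K),
      IsIrreduciblyCovariantChannel π σ Ψ ∧ Φ = (c : ℂ) • Ψ := by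
  have := nontrivial_of_isIrreducible π
  have := nontrivial_of_isIrreducible σ
  obtain ⟨z, hz⟩ := hEq.exists_trace_comp_eq_smul_trace
  obtain ⟨c, hc, rfl⟩ :=
    RCLike.nonneg_iff_exists_ofReal.1 (hCP.nonneg_of_trace_comp_eq_smul_trace hz)
  refine ⟨c, hc, ?_⟩
  obtain rfl | hc := hc.eq_or_lt
  · have hΦ : Φ = 0 := hCP.eq_zero_of_trace_comp_eq_zero (by simpa using hz)
    exact ⟨depolarizing H K,
      ⟨isQuantumChannel_depolarizing, isEquivariant_depolarizing π σ, hπ, hσ⟩, by simp [hΦ]⟩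
  · exact ⟨(c : ℂ)⁻¹ • Φ, ⟨hCP.isQuantumChannel_inv_smul hc hz, hEq.smul _, hπ, hσ⟩,
      (smul_inv_smul₀ (Complex.ofReal_ne_zero.2 hc.ne') Φ).symm⟩

theorem corollary4p2 (r m : ℕ)
    (Φ : (SU2Covariant.BinaryForm r →ₗ[ℂ] SU2Covariant.BinaryForm r) →ₗ[ℂ]
      (SU2Covariant.BinaryForm m →ₗ[ℂ] SU2Covariant.BinaryForm m))
    (hCP : SU2Covariant.IsCompletelyPositive Φ)
    (hEq : SU2Covariant.IsEquivariant (SU2Covariant.rho r) (SU2Covariant.rho m) Φ) :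
    ∃ c : ℝ, 0 ≤ c ∧
      ∃ Ψ : (SU2Covariant.BinaryForm r →ₗ[ℂ] SU2Covariant.BinaryForm r) →ₗ[ℂ]
          (SU2Covariant.BinaryForm m →ₗ[ℂ] SU2Covariant.BinaryForm m),
        SU2Covariant.IsIrreduciblyCovariantChannel (SU2Covariant.rho r) (SU2Covariant.rho m) Ψ ∧
          Φ = (c : ℂ) • Ψ := by
  have := SU2Covariant.rho_isIrreducible r
  have := SU2Covariant.rho_isIrreducible m
  exact corollary4p2_general _ _ hCP hEq
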